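/- **Transition algebra (TA).** A *signature* is a triple $\Sigma=(S,F,L)$ of a set $S$ of sorts, a set $F$ of function symbols $\sigma:w\to s$ with $w\in S^*$, $s\in S$, and a set $L$ of transition labels. A $\Sigma$-*model* $\mathfrak A$ interprets each sort $s$ as a (possibly empty) set $\mathfrak A_s$, each $\sigma:s_1\dots s_n\to s$ as a function $\mathfrak A_{s_1}\times\dots\times\mathfrak A_{s_n}\to\mathfrak A_s$, and each label $\varrho$ as a family of relations $\varrho^{\mathfrak A}_s\subseteq\mathfrak A_s\times\mathfrak A_s$ ($s\in S$). *Actions* are given by $\mathfrak a::=\varrho\mid\mathfrak a;\mathfrak a\mid\mathfrak a\cup\mathfrak a\mid\mathfrak a^*$ and are interpreted sortwise, with $;$ as composition, $\cup$ as union and ${}^*$ as reflexive-transitive closure of binary relations. *Sentences* are given by $\phi::=t=t'\mid\mathfrak a(t_1,t_2)\mid\neg\phi\mid\bigvee\Phi\mid\exists X\,\phi'$, where $t,t'$ and $t_1,t_2$ are pairs of $\Sigma$-terms of equal sort, $\mathfrak a$ is an action, $\Phi$ is a finite set of $\Sigma$-sentences, $X$ is a finite block of sorted variables with names from a countably infinite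 set, and $\phi'$ is a sentence over the signature $\Sigma[X]$ obtained by adding the elements of $X$ as new constants. Satisfaction is the usual one: $\mathfrak A\models\mathfrak a(t_1,t_2)$ iff $(t_1^{\mathfrak A},t_2^{\mathfrak A})\in\mathfrak a^{\mathfrak A}$, and $\mathfrak A\models\exists X\,\phi'$ iff some expansion of $\mathfrak A$ to $\Sigma[X]$ satisfies $\phi'$. Let $\mathsf{Sen}(\Sigma)$ be the set of $\Sigma$-sentences. For an infinite cardinal $\alpha$: * the *$\alpha$-Upward Löwenheim–Skolem property* ($\alpha$-ULS) holds if for every signature $\Sigma=(S,F,L)$, every $\Sigma$-model $\mathfrak A$ and every sort $s\in S$ with $\alpha\ge\mathrm{card}(\mathsf{Sen}(\Sigma))$ and $\alpha\ge\mathrm{card}(\mathfrak A_s)\ge\omega$ there is an elementary extension $\mathfrak B$ of $\mathfrak A$ with $\mathrm{card}(\mathfrak B_s)=\alpha$; * *$\alpha$-compactness* holds if for every signature $\Sigma$ and every set $\Phi$ of $\Sigma$-sentences, $\Phi$ has a model if and only if every subset $\Psi\subseteq\Phi$ with $\mathrm{card}(\Psi)<\alpha$ has a model. **Corollary.** Assume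 the Generalized Continuum Hypothesis ($2^\kappa=\kappa^+$ for every infinite cardinal $\kappa$) and that there are no inaccessible cardinals. Then, in full TA, (a) $\alpha$-ULS fails for every cardinal $\alpha>\omega$; and (b) $\alpha$-compactness fails for every infinite cardinal $\alpha$. -/

import Mathlib

universe u

namespace TA

open Cardinal

/-- A signature `(S, F, L)`: a set of sorts, a set of function symbols `σ : w → s` for every arity
`w ∈ S*` and sort `s`, and a set of (polymorphic) transition labels. -/
structure Signature where
  S : Type u
  F : List S → S → Type u
  L : Type u

/-- A model: a (possibly empty) carrier for every sort, a function for every function symbol, and,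
for every label, a binary relation on the carrier of every sort. -/
structure Model (Sg : Signature.{u}) where
  carrier : Sg.S → Type u
  op : ∀ {w : List Sg.S} {s : Sg.S}, Sg.F w s →
    (∀ i : Fin w.length, carrier (w.get i)) → carrier s
  rel : Sg.L → ∀ s : Sg.S, carrier s → carrier s → Prop

/-- Actions over a set of labels: `a ::= ϱ | a ⨟ a | a ∪ a | a*`. -/
inductive Action (L : Type u) : Type u
  | label : L → Action L
  | comp : Action L → Action L → Action L
  | union : Action L → Action L → Action L
  | star : Action L → Action L

/-- A finite block of variables: a finite set of pairs (name, sort) in which one name does not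
occur with two sorts. -/
structure Block (S : Type u) where
  vars : Finset (ℕ × S)
  consistent : ∀ (i : ℕ) (s₁ s₂ : S), (i, s₁) ∈ vars → (i, s₂) ∈ vars → s₁ = s₂

/-- The variables of sort `s` adjoined by a list of nested blocks. The variables of an inner block
are always distinct from those of the outer blocks. -/
inductive Var {S : Type u} : List (Block S) → S → Type u
  | here {Γ : List (Block S)} {X : Block S} {s : S} (i : ℕ) (h : (i, s) ∈ X.vars) : Var (X :: Γ) s
  | there {Γ : List (Block S)} {X : Block S} {s : S} (x : Var Γ s) : Var (X :: Γ) s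

/-- Terms over the signature `Sg[Γ]`, that is, `Sg` with the variables of the blocks in `Γ`
adjoined as new constants. -/
inductive Term (Sg : Signature.{u}) (Γ : List (Block Sg.S)) : Sg.S → Type u
  | var {s : Sg.S} (x : Var Γ s) : Term Sg Γ s
  | app {w : List Sg.S} {s : Sg.S} (σ : Sg.F w s)
      (ts : ∀ i : Fin w.length, Term Sg Γ (w.get i)) : Term Sg Γ s

/-- Sentences over the signature `Sg[Γ]`. The quantifier `∃ X` takes a sentence over `Sg[Γ][X]`;
finite disjunctions are indexed by `Fin n`, where `n = 0` gives falsity. -/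
inductive Formula (Sg : Signature.{u}) : List (Block Sg.S) → Type u
  | eq {Γ : List (Block Sg.S)} {s : Sg.S} (t t' : Term Sg Γ s) : Formula Sg Γ
  | trans {Γ : List (Block Sg.S)} {s : Sg.S} (a : Action Sg.L) (t₁ t₂ : Term Sg Γ s) : Formula Sg Γ
  | neg {Γ : List (Block Sg.S)} (φ : Formula Sg Γ) : Formula Sg Γ
  | disj {Γ : List (Block Sg.S)} {n : ℕ} (φ : Fin n → Formula Sg Γ) : Formula Sg Γ
  | ex {Γ : List (Block Sg.S)} (X : Block Sg.S) (φ : Formula Sg (X :: Γ)) : Formula Sg Γ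

/-- `Sen(Sg)`: the sentences over `Sg`, in which no variables have been adjoined. -/
abbrev Sentence (Sg : Signature.{u}) : Type u := Formula Sg []

namespace Model

variable {Sg : Signature.{u}}

/-- The interpretation of an action as a binary relation on the carrier of every sort. -/
def act (A : Model Sg) : Action Sg.L → ∀ s : Sg.S, A.carrier s → A.carrier s → Prop
  | .label r, s => A.rel r s
  | .comp a b, s => Relation.Comp (A.act a s) (A.act b s)
  | .union a b, s => fun x y => A.act a s x y ∨ A.act b s x y
  | .star a, s => Relation.ReflTransGen (A.act a s)

/-- Valuations of the variables in `Γ`, i.e. expansions of `A` to the signature `Sg[Γ]`. -/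
abbrev Valuation (A : Model Sg) (Γ : List (Block Sg.S)) : Type u :=
  ∀ s : Sg.S, Var Γ s → A.carrier s

/-- The interpretation of terms. -/
def eval (A : Model Sg) {Γ : List (Block Sg.S)} (v : A.Valuation Γ) :
    ∀ {s : Sg.S}, Term Sg Γ s → A.carrier s
  | s, .var x => v s x
  | _, .app σ ts => A.op σ (fun i => A.eval v (ts i))

/-- Satisfaction of `Sg[Γ]`-sentences in the expansion of `A` given by a valuation. -/
def Sat (A : Model Sg) : ∀ {Γ : List (Block Sg.S)}, A.Valuation Γ → Formula Sg Γ → Prop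
  | _, v, .eq t t' => A.eval v t = A.eval v t'
  | _, v, .trans (s := s) a t₁ t₂ => A.act a s (A.eval v t₁) (A.eval v t₂)
  | _, v, .neg φ => ¬ A.Sat v φ
  | _, v, .disj φ => ∃ i, A.Sat v (φ i)
  | Γ, v, .ex X φ => ∃ v' : A.Valuation (X :: Γ),
      (∀ (s : Sg.S) (x : Var Γ s), v' s (.there x) = v s x) ∧ A.Sat v' φ

/-- `A ⊨ φ` for a `Sg`-sentence `φ`. -/
def Satisfies (A : Model Sg) (φ : Sentence Sg) : Prop :=
  A.Sat (fun _ (x : Var [] _) => nomatch x) φ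

/-- `h` is an elementary embedding: it preserves and reflects the truth of all formulas at all
parameters from `A`. -/
def IsElementary (A B : Model Sg) (h : ∀ s : Sg.S, A.carrier s → B.carrier s) : Prop :=
  ∀ (Γ : List (Block Sg.S)) (v : A.Valuation Γ) (φ : Formula Sg Γ),
    A.Sat v φ ↔ B.Sat (fun s x => h s (v s x)) φ

/-- `B` is, up to identification of `A` with its image, an elementary extension of `A`. -/
def IsElementaryExtension (A B : Model Sg) : Prop :=
  ∃ h : ∀ s : Sg.S, A.carrier s → B.carrier s, IsElementary A B h

end Model

/-- The set of sentences `Φ` has a model. -/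
def HasModel {Sg : Signature.{u}} (Φ : Set (Sentence Sg)) : Prop :=
  ∃ A : Model Sg, ∀ φ ∈ Φ, A.Satisfies φ

/-- The `α`-Upward Löwenheim–Skolem property. -/
def UpwardLowenheimSkolem (α : Cardinal.{u}) : Prop :=
  ∀ (Sg : Signature.{u}) (A : Model Sg) (s : Sg.S),
    #(Sentence Sg) ≤ α → #(A.carrier s) ≤ α → ℵ₀ ≤ #(A.carrier s) →
    ∃ B : Model Sg, A.IsElementaryExtension B ∧ #(B.carrier s) = α

/-- `α`-compactness. -/
def Compactness (α : Cardinal.{u}) : Prop :=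
  ∀ (Sg : Signature.{u}) (Φ : Set (Sentence Sg)),
    HasModel Φ ↔ ∀ Ψ : Set (Sentence Sg), Ψ ⊆ Φ → #Ψ < α → HasModel Ψ

/-- The Generalized Continuum Hypothesis for the cardinals of `Type u`. -/
def GCH : Prop :=
  ∀ c : Cardinal.{u}, ℵ₀ ≤ c → 2 ^ c = Order.succ c

/-- There are no inaccessible cardinals in `Type u`. -/
def NoInaccessible : Prop :=
  ∀ c : Cardinal.{u}, ¬ c.IsInaccessible

end TA

namespace TA

open Cardinal Set

/-! The operator `*` expresses that every element is reached from zero by finitely many successor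
steps, which forces standard naturals. Part (a): in `ℕ` with a constant for each number,
functionality of the label and reachability from zero leave only the values of the constants, so
every elementary extension is countable, and so is the language. Part (b): for `#A = α`, take every
function `A → ℕ` as a constant, evaluated at a point `a`, and the theory `almostTrue A`. Each of its
sentences fails at no more than one point, so fewer than `α` of them hold together at some point
(`hasModel_of_subset_almostTrue`). In a model of the whole theory every constant equals a standard
number, so the sets containing the generic point form a countably complete nonprincipal ultrafilter
(`isSelector_of_satisfies`). The least number of small sets with large union is then uncountable,
regular and a strong limit (`isInaccessible_completeness`), contradicting the absence of
inaccessibles. -/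

/-- A family of subsets of `A` which selects exactly one part of every countable partition of `A`
and contains no singleton, i.e. a countably complete nonprincipal ultrafilter. -/
structure IsSelector {A : Type} (U : Set (Set A)) : Prop where
  exists_fiber_mem : ∀ f : A → ℕ, ∃ n, f ⁻¹' {n} ∈ U
  inter_nonempty : ∀ X ∈ U, ∀ Y ∈ U, (X ∩ Y).Nonempty
  singleton_notMem : ∀ a, {a} ∉ U

/-! ### Countably complete ultrafilters yield inaccessible cardinals -/

namespace IsSelector

variable {A : Type} {U : Set (Set A)}

theorem empty_notMem (hU : IsSelector U) : ∅ ∉ U := fun h => by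
  simpa using hU.inter_nonempty _ h _ h

theorem mem_or_compl_mem (hU : IsSelector U) (X : Set A) : X ∈ U ∨ Xᶜ ∈ U := by
  classical
  obtain ⟨n, hn⟩ := hU.exists_fiber_mem fun a => if a ∈ X then 0 else 1
  rcases n with _ | _ | n
  · left
    convert hn using 1
    ext a; by_cases h : a ∈ X <;> simp [h]
  · right
    convert hn using 1
    ext a; by_cases h : a ∈ X <;> simp [h]
  · refine absurd ?_ hU.empty_notMem
    convert hn using 1
    ext a; by_cases h : a ∈ X <;> simp [h]

theorem mem_of_subset (hU : IsSelector U) {X Y : Set A} (hX : X ∈ U) (h : X ⊆ Y) : Y ∈ U := by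
  refine (hU.mem_or_compl_mem Y).resolve_right fun hY => ?_
  obtain ⟨a, ha, ha'⟩ := hU.inter_nonempty _ hX _ hY
  exact ha' (h ha)

theorem univ_mem (hU : IsSelector U) : Set.univ ∈ U := by
  simpa [hU.empty_notMem] using hU.mem_or_compl_mem Set.univ

theorem compl_mem (hU : IsSelector U) {X : Set A} (hX : X ∉ U) : Xᶜ ∈ U :=
  (hU.mem_or_compl_mem X).resolve_left hX

theorem iUnion_nat_notMem (hU : IsSelector U) {X : ℕ → Set A} (hX : ∀ n, X n ∉ U) :
    ⋃ n, X n ∉ U := by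
  classical
  intro h
  -- Partition by the least index of a set containing `a`, shifted by one; the value 0 marks the
  -- complement of the union.
  let f : A → ℕ := fun a => if ha : ∃ n, a ∈ X n then Nat.find ha + 1 else 0
  obtain ⟨n, hn⟩ := hU.exists_fiber_mem f
  rcases n with _ | n
  · obtain ⟨a, ha, ha'⟩ := hU.inter_nonempty _ h _ hn
    have : ∃ n, a ∈ X n := by simpa using ha
    simp [f, this] at ha'
  · refine hX n (hU.mem_of_subset hn fun a ha => ?_)
    by_cases h' : ∃ n, a ∈ X n
    · have : Nat.find h' = n := by simpa [f, h'] using ha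
      exact this ▸ Nat.find_spec h'
    · simp [f, h'] at ha

theorem iUnion_countable_notMem (hU : IsSelector U) {J : Type} [Countable J] {X : J → Set A}
    (hX : ∀ j, X j ∉ U) : ⋃ j, X j ∉ U := by
  cases isEmpty_or_nonempty J
  · simpa using hU.empty_notMem
  · obtain ⟨e, he⟩ := exists_surjective_nat J
    rw [← he.iUnion_comp]
    exact hU.iUnion_nat_notMem fun n => hX (e n)

theorem union_notMem (hU : IsSelector U) {X Y : Set A} (hX : X ∉ U) (hY : Y ∉ U) :
    X ∪ Y ∉ U := by
  rw [union_eq_iUnion]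
  exact hU.iUnion_countable_notMem fun b => by cases b <;> assumption

/-- The cardinalities of families of small sets with large union. -/
def largeUnionCards (U : Set (Set A)) : Set Cardinal.{0} :=
  {c | ∃ (J : Type) (X : J → Set A), #J = c ∧ (∀ j, X j ∉ U) ∧ ⋃ j, X j ∈ U}

/-- The least cardinality of a family of small sets with large union. -/
noncomputable def completeness (U : Set (Set A)) : Cardinal.{0} := sInf (largeUnionCards U)

theorem completeness_mem (hU : IsSelector U) : completeness U ∈ largeUnionCards U := by
  -- The singletons are small and cover `A`, so the infimum is over a nonempty set and is attained.
  refine csInf_mem ⟨#A, A, fun a => {a}, rfl, hU.singleton_notMem, ?_⟩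
  rw [iUnion_of_singleton]
  exact hU.univ_mem

theorem iUnion_notMem {K : Type} (hK : #K < completeness U) {X : K → Set A}
    (hX : ∀ k, X k ∉ U) : ⋃ k, X k ∉ U := fun h =>
  notMem_of_lt_csInf hK (OrderBot.bddBelow _) ⟨K, X, rfl, hX, h⟩

theorem aleph0_lt_completeness (hU : IsSelector U) : ℵ₀ < completeness U := by
  by_contra! h
  obtain ⟨J, X, hJ, hX, hX'⟩ := hU.completeness_mem
  have : Countable J := by rwa [← mk_le_aleph0_iff, hJ]
  exact hU.iUnion_countable_notMem hX hX'

/-- Index a minimal family by an initial ordinal and regroup it along a cofinal set. Each group is a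
union over a proper initial segment, hence small; a short cofinal set would make the whole union
small. -/
theorem completeness_le_cof (hU : IsSelector U) :
    completeness U ≤ (completeness U).ord.cof := by
  obtain ⟨J, X, hJ, hX, hX'⟩ := hU.completeness_mem
  obtain ⟨e⟩ : Nonempty ((completeness U).ord.ToType ≃ J) := by
    rw [← Cardinal.eq, hJ, mk_ord_toType]
  rw [← Ordinal.cof_toType]
  obtain ⟨s, hs, hs'⟩ := Order.exists_cof_eq (α := (completeness U).ord.ToType)
  rw [← hs']
  by_contra! hlt
  refine iUnion_notMem hlt (X := fun y : s => ⋃ x : Iic y.1, X (e x)) (fun y => ?_) ?_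
  · refine iUnion_notMem ?_ fun x => hX _
    rw [← Iio_insert]
    refine (mk_insert_le).trans_lt (add_lt_of_lt hU.aleph0_lt_completeness.le ?_ ?_)
    · simpa using mk_Iio_lt y.1 (by simp)
    · exact one_lt_aleph0.trans hU.aleph0_lt_completeness
  · refine hU.mem_of_subset hX' (iUnion_subset fun j a ha => ?_)
    obtain ⟨y, hy, hjy⟩ := hs (e.symm j)
    exact mem_iUnion.2 ⟨⟨y, hy⟩, mem_iUnion.2 ⟨⟨e.symm j, hjy⟩, by simpa using ha⟩⟩

/-- Otherwise the index set `J` of a minimal family injects into the subsets of `K`. The ultrafilter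
decides each of the `#K` bits of the code of an index; since fewer than `completeness U` small sets
have small union, almost all points carry the same code, hence lie in a single small `X j`. -/
theorem two_power_lt_completeness (hU : IsSelector U) {c : Cardinal.{0}}
    (hc : c < completeness U) : 2 ^ c < completeness U := by
  classical
  obtain ⟨J, X, hJ, hX, hX'⟩ := hU.completeness_mem
  induction c using Cardinal.inductionOn with | _ K
  by_contra! hle
  rw [← hJ, ← mk_set] at hle
  obtain ⟨g⟩ := hle
  have : ∀ a ∈ ⋃ j, X j, ∃ j, a ∈ X j := fun a ha => by simpa using ha
  have : Nonempty J := by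
    obtain ⟨a, ha, -⟩ := hU.inter_nonempty _ hX' _ hX'
    exact ⟨(this a ha).choose⟩
  choose! i hi using ‹∀ a ∈ ⋃ j, X j, ∃ j, a ∈ X j›
  let Z : K → Set A := fun k => {a | k ∈ g (i a)}
  -- The code obtained by letting the ultrafilter decide each bit.
  let E : Set K := {k | Z k ∈ U}
  have hN : ⋃ k, {a | ¬ (k ∈ g (i a) ↔ k ∈ E)} ∉ U := by
    refine iUnion_notMem hc fun k hk => ?_
    by_cases hE : k ∈ E
    · obtain ⟨a, ha, ha'⟩ := hU.inter_nonempty _ hk _ hE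
      exact ha (iff_of_true ha' hE)
    · obtain ⟨a, ha, ha'⟩ := hU.inter_nonempty _ hk _ (hU.compl_mem hE)
      exact ha (iff_of_false ha' hE)
  have hsub : (⋃ j, X j) ⊆ (⋃ k, {a | ¬ (k ∈ g (i a) ↔ k ∈ E)}) ∪
      {a | a ∈ ⋃ j, X j ∧ g (i a) = E} := by
    intro a ha
    by_cases h : g (i a) = E
    · exact Or.inr ⟨ha, h⟩
    · left
      obtain ⟨k, hk⟩ : ∃ k, ¬ (k ∈ g (i a) ↔ k ∈ E) := by
        by_contra! h'
        exact h (Set.ext h')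
      exact mem_iUnion.2 ⟨k, hk⟩
  refine hU.union_notMem hN (fun hE => ?_) (hU.mem_of_subset hX' hsub)
  obtain ⟨a, ⟨ha, hga⟩, -⟩ := hU.inter_nonempty _ hE _ hE
  refine hX (i a) (hU.mem_of_subset hE fun b hb => ?_)
  rw [g.injective (hga.trans hb.2.symm)]
  exact hi b hb.1

theorem isInaccessible_completeness (hU : IsSelector U) : (completeness U).IsInaccessible :=
  isInaccessible_def.2 ⟨hU.aleph0_lt_completeness,
    ⟨hU.aleph0_lt_completeness.le, hU.completeness_le_cof⟩,
    ⟨(aleph0_pos.trans hU.aleph0_lt_completeness).ne', fun _ => hU.two_power_lt_completeness⟩⟩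

end IsSelector

/-! ### Sentences about the successor relation -/

/-- The function symbols of a one-sorted signature with constants `I` only. -/
def constSymbol (I : Type) : List Unit → Unit → Type
  | [], _ => I
  | _ :: _, _ => Empty

/-- The one-sorted signature with constants `I` and a single label. -/
abbrev constSig (I : Type) : Signature.{0} where
  S := Unit
  F := constSymbol I
  L := Unit

/-- The natural numbers with the successor relation and the constants interpreted by `v`. -/
def natModel {I : Type} (v : I → ℕ) : Model (constSig I) where
  carrier _ := ℕ
  op {w _} := match w with
    | [] => fun (i : I) _ => v i
    | _ :: _ => fun (e : Empty) _ => e.elim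
  rel _ _ m n := n = m + 1

section Formulas

variable {I : Type} {Γ : List (Block Unit)}

/-- The constant `i` as a term. -/
def constTerm (Γ : List (Block Unit)) (i : I) : Term (constSig I) Γ () :=
  .app (w := []) (i : constSymbol I [] ()) fun j => j.elim0

/-- The value of the constant `i` in a model. -/
def constVal (B : Model (constSig I)) (i : I) : B.carrier () :=
  B.op (w := []) (s := ()) (i : constSymbol I [] ()) fun j => j.elim0

@[simp]
theorem eval_constTerm (B : Model (constSig I)) (v : B.Valuation Γ) (i : I) :
    B.eval v (constTerm Γ i) = constVal B i := by
  simp only [constTerm, Model.eval, constVal]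
  congr 1
  exact funext fun j => j.elim0

/-- The block of the variables with names below `n`. -/
def block (n : ℕ) : Block Unit where
  vars := (Finset.range n).map ⟨fun i => (i, ()), fun _ _ h => congrArg Prod.fst h⟩
  consistent _ _ _ _ _ := rfl

theorem mem_block {n i : ℕ} (h : i < n) : (i, ()) ∈ (block n).vars := by
  exact Finset.mem_map.2 ⟨i, Finset.mem_range.2 h, rfl⟩

/-- The variable `i` of the innermost block as a term. -/
def varTerm (n i : ℕ) (h : i < n) : Term (constSig I) [block n] () :=
  .var (.here i (mem_block h))

/-- The sentence `∀ x y z, ϱ(x, y) → ϱ(x, z) → y = z`. -/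
def functional (I : Type) : Sentence (constSig I) :=
  .neg (.ex (block 3) (.neg (.disj ![
    .neg (.trans (.label ()) (varTerm 3 0 (by decide)) (varTerm 3 1 (by decide))),
    .neg (.trans (.label ()) (varTerm 3 0 (by decide)) (varTerm 3 2 (by decide))),
    .eq (varTerm 3 1 (by decide)) (varTerm 3 2 (by decide))])))

/-- The sentence `∀ x, ϱ*(i, x)`. -/
def reachable (i : I) : Sentence (constSig I) :=
  .neg (.ex (block 1) (.neg
    (.trans (.star (.label ())) (constTerm _ i) (varTerm 1 0 (by decide)))))

/-- A valuation of a single block of variables. -/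
def blockVal (B : Model (constSig I)) {n : ℕ} (b : ℕ → B.carrier ()) : B.Valuation [block n]
  | (), .here i _ => b i

theorem satisfies_functional (B : Model (constSig I)) :
    B.Satisfies (functional I) ↔
      ∀ x y z, B.rel () () x y → B.rel () () x z → y = z := by
  simp only [Model.Satisfies, functional, Model.Sat, varTerm]
  constructor
  · intro h x y z hxy hxz
    by_contra hne
    refine h ⟨blockVal B fun i => if i = 0 then x else if i = 1 then y else z,
      (nofun), ?_⟩
    rintro ⟨i, hi⟩
    fin_cases i
    · exact hi hxy
    · exact hi hxz
    · exact hne hi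
  · rintro h ⟨v, -, hv⟩
    refine hv ?_
    by_cases h1 : B.rel () () (v () (.here 0 (mem_block (by decide))))
      (v () (.here 1 (mem_block (by decide))))
    · by_cases h2 : B.rel () () (v () (.here 0 (mem_block (by decide))))
        (v () (.here 2 (mem_block (by decide))))
      · exact ⟨2, h _ _ _ h1 h2⟩
      · exact ⟨1, h2⟩
    · exact ⟨0, h1⟩

theorem satisfies_reachable (B : Model (constSig I)) (i : I) :
    B.Satisfies (reachable i) ↔
      ∀ x, Relation.ReflTransGen (B.rel () ()) (constVal B i) x := by
  simp only [Model.Satisfies, reachable, Model.Sat, varTerm, Model.eval, Model.act,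
    eval_constTerm]
  constructor
  · intro h x
    by_contra hx
    exact h ⟨blockVal B fun _ => x, (nofun), hx⟩
  · rintro h ⟨v, -, hv⟩
    exact hv (h _)

/-- The sentence `i = j`. -/
def eqSentence (i j : I) : Sentence (constSig I) := .eq (constTerm [] i) (constTerm [] j)

/-- The sentence `ϱ(i, j)`. -/
def stepSentence (i j : I) : Sentence (constSig I) :=
  .trans (.label ()) (constTerm [] i) (constTerm [] j)

/-- The sentence `ϱ*(i, j)`. -/
def starSentence (i j : I) : Sentence (constSig I) :=
  .trans (.star (.label ())) (constTerm [] i) (constTerm [] j)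

@[simp]
theorem satisfies_eqSentence (B : Model (constSig I)) (i j : I) :
    B.Satisfies (eqSentence i j) ↔ constVal B i = constVal B j := by
  simp [Model.Satisfies, eqSentence, Model.Sat]

@[simp]
theorem satisfies_stepSentence (B : Model (constSig I)) (i j : I) :
    B.Satisfies (stepSentence i j) ↔ B.rel () () (constVal B i) (constVal B j) := by
  simp [Model.Satisfies, stepSentence, Model.Sat, Model.act]

@[simp]
theorem satisfies_starSentence (B : Model (constSig I)) (i j : I) :
    B.Satisfies (starSentence i j) ↔
      Relation.ReflTransGen (B.rel () ()) (constVal B i) (constVal B j) := by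
  simp [Model.Satisfies, starSentence, Model.Sat, Model.act]

@[simp]
theorem satisfies_neg {Sg : Signature.{0}} (B : Model Sg) (φ : Sentence Sg) :
    B.Satisfies (.neg φ) ↔ ¬ B.Satisfies φ := by
  simp [Model.Satisfies, Model.Sat]

@[simp]
theorem satisfies_disj_pair {Sg : Signature.{0}} (B : Model Sg) (φ ψ : Sentence Sg) :
    B.Satisfies (.disj ![φ, ψ]) ↔ B.Satisfies φ ∨ B.Satisfies ψ := by
  simp [Model.Satisfies, Model.Sat, Fin.exists_fin_two]

end Formulas

theorem reflTransGen_succ (n : ℕ) :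
    Relation.ReflTransGen (fun m n : ℕ => n = m + 1) 0 n := by
  induction n with
  | zero => exact .refl
  | succ n ih => exact ih.tail rfl

/-- If a functional relation leads from `c n` to `c (n + 1)`, then everything reachable from `c 0`
is of the form `c n`. -/
theorem exists_eq_of_reflTransGen {β : Type*} {r : β → β → Prop}
    (hr : ∀ x y z, r x y → r x z → y = z) {c : ℕ → β} (hc : ∀ n, r (c n) (c (n + 1))) {y : β}
    (hy : Relation.ReflTransGen r (c 0) y) : ∃ n, y = c n := by
  induction hy with
  | refl => exact ⟨0, rfl⟩
  | tail _ h ih =>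
    obtain ⟨n, rfl⟩ := ih
    exact ⟨n + 1, hr _ _ _ h (hc n)⟩

theorem natModel_satisfies_functional {I : Type} (v : I → ℕ) :
    (natModel v).Satisfies (functional I) :=
  (satisfies_functional _).2 fun _ _ _ hy hz => Eq.trans hy (Eq.symm hz)

/-! ### Failure of compactness -/

section Compactness

variable {A : Type}

/-- The sentences over the constants `A → ℕ` that hold in `ℕ` with the constants evaluated at `a`,
for all `a` with at most one exception. -/
def almostTrue (A : Type) : Set (Sentence (constSig (A → ℕ))) :=
  {φ | {a | ¬ (natModel fun f : A → ℕ => f a).Satisfies φ}.Subsingleton}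

theorem mem_almostTrue {φ : Sentence (constSig (A → ℕ))}
    (h : ∀ a, (natModel fun f : A → ℕ => f a).Satisfies φ) : φ ∈ almostTrue A :=
  fun a ha => absurd (h a) ha

/-- If no point gives a model, choose for each point a sentence of `Ψ` failing there. A sentence has
at most one exception, so the choice is injective and `#A ≤ #Ψ`. -/
theorem hasModel_of_subset_almostTrue {Ψ : Set (Sentence (constSig (A → ℕ)))}
    (hΨ : Ψ ⊆ almostTrue A) (hcard : #Ψ < #A) : HasModel Ψ := by
  by_contra hno
  have hbad : ∀ a, ∃ φ : Ψ, ¬ (natModel fun f : A → ℕ => f a).Satisfies φ := fun a => by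
    by_contra! h
    exact hno ⟨_, fun φ hφ => h ⟨φ, hφ⟩⟩
  choose g hg using hbad
  refine hcard.not_ge (mk_le_of_injective (f := g) fun a b hab => ?_)
  exact hΨ (g a).2 (hg a) (hab ▸ hg b)

open Classical in
/-- The indicator function of a set. -/
noncomputable def indicatorNat (X : Set A) (a : A) : ℕ := if a ∈ X then 1 else 0

theorem indicatorNat_eq_one {X : Set A} {a : A} : indicatorNat X a = 1 ↔ a ∈ X := by
  simp [indicatorNat]

/-- The sentence saying that the generic element belongs to `X`. -/
noncomputable def memSentence (X : Set A) : Sentence (constSig (A → ℕ)) :=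
  eqSentence (indicatorNat X) fun _ => 1

theorem natModel_satisfies_memSentence (X : Set A) (a : A) :
    (natModel fun f : A → ℕ => f a).Satisfies (memSentence X) ↔ a ∈ X := by
  rw [memSentence, satisfies_eqSentence]
  exact indicatorNat_eq_one

/-- Reachability from zero makes the constant `f` equal to some standard `n`, and this `n` picks the
fiber. Only the exclusion of singletons needs the permitted exception. -/
theorem isSelector_of_satisfies {B : Model (constSig (A → ℕ))}
    (hB : ∀ φ ∈ almostTrue A, B.Satisfies φ) : IsSelector {X | B.Satisfies (memSentence X)} where
  exists_fiber_mem f := by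
    have hfun := (satisfies_functional B).1
      (hB _ (mem_almostTrue fun a => natModel_satisfies_functional _))
    have hstep : ∀ n : ℕ, B.rel () () (constVal B fun _ : A => n)
        (constVal B fun _ : A => n + 1) := fun n =>
      (satisfies_stepSentence B _ _).1 (hB _ (mem_almostTrue fun a =>
        (satisfies_stepSentence _ _ _).2 rfl))
    have hreach := (satisfies_starSentence B (fun _ => 0) f).1 (hB _ (mem_almostTrue fun a =>
      (satisfies_starSentence _ _ _).2 (reflTransGen_succ (f a))))
    obtain ⟨n, hn⟩ := exists_eq_of_reflTransGen (c := fun n => constVal B fun _ : A => n)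
      hfun hstep hreach
    refine ⟨n, ?_⟩
    have himp : B.Satisfies (.disj ![.neg (eqSentence f fun _ => n), memSentence (f ⁻¹' {n})]) := by
      refine hB _ (mem_almostTrue fun a => ?_)
      rw [satisfies_disj_pair, satisfies_neg, satisfies_eqSentence,
        natModel_satisfies_memSentence]
      exact (em (f a = n)).symm
    rw [satisfies_disj_pair, satisfies_neg, satisfies_eqSentence] at himp
    exact himp.resolve_left (not_not_intro hn)
  inter_nonempty X hX Y hY := by
    by_contra hne
    have himp : B.Satisfies (.disj ![.neg (memSentence X), .neg (memSentence Y)]) := by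
      refine hB _ (mem_almostTrue fun a => ?_)
      rw [satisfies_disj_pair, satisfies_neg, satisfies_neg, natModel_satisfies_memSentence,
        natModel_satisfies_memSentence, ← not_and_or]
      exact fun h => hne ⟨a, h⟩
    rw [satisfies_disj_pair, satisfies_neg, satisfies_neg] at himp
    exact himp.elim (fun h => h hX) fun h => h hY
  singleton_notMem a := by
    rw [Set.mem_ofPred_eq, ← satisfies_neg]
    -- The negated membership sentence fails only at `a` itself.
    refine hB _ fun b hb c hc => ?_
    simp only [Set.mem_ofPred_eq, satisfies_neg, natModel_satisfies_memSentence, not_not,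
      Set.mem_singleton_iff] at hb hc
    exact hb.trans hc.symm

theorem not_compactness (hIC : NoInaccessible.{0}) (α : Cardinal.{0}) : ¬ Compactness α := by
  induction α using Cardinal.inductionOn with | _ A
  intro hcomp
  obtain ⟨B, hB⟩ := (hcomp _ (almostTrue A)).2 fun Ψ hΨ => hasModel_of_subset_almostTrue hΨ
  exact hIC _ (isSelector_of_satisfies hB).isInaccessible_completeness

end Compactness

/-! ### Countability of the language -/

section Countability

instance : Countable (Block Unit) :=
  Function.Injective.countable (f := Block.vars) fun X Y h => by
    cases X; cases Y; congr

theorem countable_of_depth {T : Type*} (d : T → ℕ) (h : ∀ n, {t | d t < n}.Countable) :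
    Countable T := by
  rw [← Set.countable_univ_iff]
  refine (Set.countable_iUnion h).mono fun t _ => Set.mem_iUnion.2 ⟨d t + 1, ?_⟩
  exact Nat.lt_succ_self (d t)

/-- The nesting depth of an action. -/
def Action.depth {L : Type} : Action L → ℕ
  | .label _ => 0
  | .comp a b => max a.depth b.depth + 1
  | .union a b => max a.depth b.depth + 1
  | .star a => a.depth + 1

instance (L : Type) [Countable L] : Countable (Action L) := by
  refine countable_of_depth Action.depth fun n => ?_
  induction n with
  | zero => simp
  | succ n ih =>
    refine ((((Set.countable_range Action.label).union (ih.image2 ih Action.comp)).union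
      (ih.image2 ih Action.union)).union (ih.image Action.star)).mono ?_
    rintro (l | ⟨a, b⟩ | ⟨a, b⟩ | a) h
    · exact .inl (.inl (.inl ⟨l, rfl⟩))
    · have h : max a.depth b.depth + 1 < n + 1 := h
      exact .inl (.inl (.inr ⟨a, show a.depth < n by omega, b, show b.depth < n by omega, rfl⟩))
    · have h : max a.depth b.depth + 1 < n + 1 := h
      exact .inl (.inr ⟨a, show a.depth < n by omega, b, show b.depth < n by omega, rfl⟩)
    · exact .inr ⟨a, Nat.lt_of_succ_lt_succ h, rfl⟩

instance (Γ : List (Block Unit)) (s : Unit) : Countable (Var Γ s) := by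
  induction Γ with
  | nil => exact Function.Injective.countable (f := fun x : Var [] s => (nomatch x : Empty)) nofun
  | cons X Γ ih =>
    refine Function.Surjective.countable
      (f := fun x : {i : ℕ // (i, s) ∈ X.vars} ⊕ Var Γ s =>
        x.elim (fun i => Var.here i.1 i.2) Var.there) ?_
    rintro (⟨i, h⟩ | x)
    · exact ⟨.inl ⟨i, h⟩, rfl⟩
    · exact ⟨.inr x, rfl⟩

instance (I : Type) [Countable I] (Γ : List (Block Unit)) (s : Unit) :
    Countable (Term (constSig I) Γ s) := by
  refine Function.Surjective.countable
    (f := fun x : Var Γ s ⊕ I => x.elim Term.var (constTerm Γ)) ?_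
  rintro (x | ⟨σ, ts⟩)
  · exact ⟨.inl x, rfl⟩
  · rename_i w
    cases w with
    | nil => exact ⟨.inr σ, congrArg (Term.app (Sg := constSig I) (w := []) σ)
        (funext fun j => j.elim0)⟩
    | cons => exact Empty.elim σ

/-- The nesting depth of a formula. -/
def Formula.depth {Sg : Signature.{0}} : ∀ {Γ : List (Block Sg.S)}, Formula Sg Γ → ℕ
  | _, .eq _ _ => 0
  | _, .trans _ _ _ => 0
  | _, .neg φ => φ.depth + 1
  | _, .disj φ => (Finset.univ.sup fun i => (φ i).depth) + 1
  | _, .ex _ φ => φ.depth + 1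

instance (I : Type) [Countable I] (Γ : List (Block Unit)) :
    Countable (Formula (constSig I) Γ) := by
  refine countable_of_depth Formula.depth fun n => ?_
  -- The context varies because a quantifier's body lives over a longer one.
  induction n generalizing Γ with
  | zero => simp
  | succ n ih =>
    have hdisj : (⋃ k : ℕ, (fun φ : Fin k → Formula (constSig I) Γ => Formula.disj φ) ''
        {φ | ∀ i, φ i ∈ {ψ | Formula.depth ψ < n}}).Countable :=
      Set.countable_iUnion fun k => (Set.countable_pi fun _ => ih Γ).image _
    have hex : (⋃ X : Block Unit, Formula.ex (Sg := constSig I) X ''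
        {ψ : Formula (constSig I) (X :: Γ) | ψ.depth < n}).Countable :=
      Set.countable_iUnion fun X => (ih (X :: Γ)).image _
    have heq := Set.countable_range fun p : Term (constSig I) Γ () × Term (constSig I) Γ () =>
      Formula.eq p.1 p.2
    have htrans := Set.countable_range
      fun p : Action Unit × Term (constSig I) Γ () × Term (constSig I) Γ () =>
        Formula.trans (Sg := constSig I) p.1 p.2.1 p.2.2
    refine ((((heq.union htrans).union ((ih Γ).image Formula.neg)).union hdisj).union hex).mono ?_
    rintro (⟨t, t'⟩ | ⟨a, t, t'⟩ | φ | φ | ⟨X, φ⟩) h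
    · exact .inl (.inl (.inl (.inl ⟨(t, t'), rfl⟩)))
    · exact .inl (.inl (.inl (.inr ⟨(a, t, t'), rfl⟩)))
    · exact .inl (.inl (.inr ⟨φ, Nat.lt_of_succ_lt_succ h, rfl⟩))
    · refine .inl (.inr (Set.mem_iUnion.2 ⟨_, φ, fun i => ?_, rfl⟩))
      exact (Finset.le_sup (f := fun i => (φ i).depth) (Finset.mem_univ i)).trans_lt
        (Nat.lt_of_succ_lt_succ h)
    · exact .inr (Set.mem_iUnion.2 ⟨X, φ, Nat.lt_of_succ_lt_succ h, rfl⟩)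

end Countability

/-! ### Failure of upward Löwenheim–Skolem -/

/-- An elementary extension satisfies the same sentences. -/
theorem satisfies_iff_of_isElementaryExtension {Sg : Signature.{0}} {A B : Model Sg}
    (h : A.IsElementaryExtension B) (φ : Sentence Sg) : A.Satisfies φ ↔ B.Satisfies φ := by
  obtain ⟨h, hh⟩ := h
  rw [Model.Satisfies, Model.Satisfies, hh]
  exact iff_of_eq (congrArg (fun v => B.Sat v φ) (funext fun s => funext nofun))

theorem not_upwardLowenheimSkolem {α : Cardinal.{0}} (hα : ℵ₀ < α) :
    ¬ UpwardLowenheimSkolem α := by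
  intro h
  obtain ⟨B, hB, hcard⟩ := h (constSig ℕ) (natModel id) () ((mk_le_aleph0).trans hα.le)
    ((mk_nat).trans_le hα.le) mk_nat.ge
  have hsat := satisfies_iff_of_isElementaryExtension hB
  have hfun := (satisfies_functional B).1 ((hsat _).1 (natModel_satisfies_functional _))
  have hreach := (satisfies_reachable B 0).1
    ((hsat _).1 ((satisfies_reachable _ _).2 reflTransGen_succ))
  have hstep : ∀ n : ℕ, B.rel () () (constVal B n) (constVal B (n + 1)) := fun n =>
    (satisfies_stepSentence B _ _).1 ((hsat _).1 ((satisfies_stepSentence _ _ _).2 rfl))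
  -- Everything is reachable from the constant 0, and by functionality the successor path never
  -- leaves the constants.
  have hsurj : Function.Surjective (constVal B) := fun y =>
    (exists_eq_of_reflTransGen hfun hstep (hreach y)).imp fun _ => Eq.symm
  have := hsurj.countable
  exact hα.not_ge (hcard ▸ mk_le_aleph0)

end TA

/-- `Type` plays the role of the universe of sets; in a higher universe of Lean there always is an
inaccessible cardinal, so that `TA.NoInaccessible` would be false there. -/
theorem corollary1 (hGCH : TA.GCH.{0}) (hIC : TA.NoInaccessible.{0}) :
    (∀ α : Cardinal.{0}, Cardinal.aleph0 < α → ¬ TA.UpwardLowenheimSkolem α) ∧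
    (∀ α : Cardinal.{0}, Cardinal.aleph0 ≤ α → ¬ TA.Compactness α) :=
  ⟨fun _ hα => TA.not_upwardLowenheimSkolem hα, fun α _ => TA.not_compactness hIC α⟩
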